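/- A rank-one quantum game is given by unit vectors $|\psi\rangle,|\gamma\rangle\in\mathcal H_A\otimes\mathcal H_B\otimes\mathcal H_C$ (all spaces finite-dimensional): a referee prepares $|\psi\rangle$, sends registers $A$ and $B$ to Alice and Bob, and after they return them measures with the projection $P=|\gamma\rangle\langle\gamma|$; the outcome $P$ means that they win. Put $M_{AB}=\mathrm{tr}_C|\psi\rangle\langle\gamma|$. The entangled value $\omega^*(G)$ is the supremum of the winning probability $$\mathrm{tr}\big((P\otimes 1_{A'B'})\,(T_{AA'}\otimes S_{BB'}\otimes \mathrm{id}_C)(|\psi\rangle|\xi\rangle\langle\psi|\langle\xi|)\big)$$ over all finite-dimensional $\mathcal H_{A'},\mathcal H_{B'}$, unit vectors $|\xi\rangle\in\mathcal H_{A'}\otimes\mathcal H_{B'}$ and quantum operations (completely positive trace-preserving maps) $T_{AA'}$ on $\mathcal H_A\otimes\mathcal H_{A'}$ and $S_{BB'}$ on $\mathcal H_B\otimes\mathcal H_{B'}$. The maximal value is $V(G)=\|M_{AB}\|_1^2$, where $\|\cdot\|_1$ is the trace norm. If $\mathcal H_A=\mathcal H_B$, then $G$ is a Schur game with multiplier matrix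 $\phi$ if the map $\widehat M_{AB}(X)_{sv}=\sum_{r,u}(M_{AB})_{(r,s),(u,v)}X_{ru}$ satisfies $\widehat M_{AB}(X)_{ij}=\phi_{ij}X_{ij}$ for all matrices $X$. For $n\ge 0$ let $A_n$ be the rank-one quantum game with $$|\psi_n\rangle=2^{-n}\big((|00\rangle+|11\rangle)_{AB}|0\rangle_C+(|00\rangle-|11\rangle)_{AB}|1\rangle_C\big)^{\otimes n},\qquad |\gamma_n\rangle=2^{-n/2}\big(|00\rangle_{AB}|0\rangle_C+|11\rangle_{AB}|1\rangle_C\big)^{\otimes n}.$$ **Theorem.** For every $n$, the game $A_n$ is a Schur game with multiplier matrix $\phi_n=2^{-3n/2}A^{\otimes n}$, where $A=\begin{pmatrix}1&1\\1&-1\end{pmatrix}$. Its maximal value is $V(A_n)=1$; moreover, the supremum of the winning probabilities of a single player with access to both $A$ and $B$ (and to an auxiliary register in an arbitrary pure state), applying an arbitrary quantum operation, is also $1$. Its entangled value, the (finite) supremum above, satisfies $\omega^*(A_n)\le 2^{-n}$. -/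

import Mathlib

open scoped Matrix Kronecker ComplexOrder

/-! ## Operators on tensor products

Finite-dimensional Hilbert spaces are the spaces `ℂ^ι` for a finite index type `ι`; the tensor
product of `ℂ^ι` and `ℂ^κ` is `ℂ^(ι × κ)`, and operators on `ℂ^ι` are matrices. -/

/-- The tensor product `T ⊗ S` of two linear maps between matrix spaces, acting on operators on a
tensor product: `S` acts on the second factor, then `T` on the first. -/
def tensorMap {ι κ : Type*} (T : Matrix ι ι ℂ →ₗ[ℂ] Matrix ι ι ℂ)
    (S : Matrix κ κ ℂ →ₗ[ℂ] Matrix κ κ ℂ) :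
    Matrix (ι × κ) (ι × κ) ℂ →ₗ[ℂ] Matrix (ι × κ) (ι × κ) ℂ where
  toFun X := Matrix.of fun p q =>
    T (Matrix.of fun i i' => S (X.submatrix (Prod.mk i) (Prod.mk i')) p.2 q.2) p.1 q.1
  map_add' X Y := by
    ext p q
    simp only [Matrix.submatrix_add, Pi.add_apply, map_add, Matrix.add_apply, Matrix.of_apply]
    rw [← Matrix.add_apply, ← map_add]
    rfl
  map_smul' r X := by
    ext p q
    simp only [Matrix.submatrix_smul, Pi.smul_apply, map_smul, Matrix.smul_apply, Matrix.of_apply,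
      RingHom.id_apply]
    rw [← Matrix.smul_apply, ← map_smul]
    rfl

theorem tensorMap_kronecker {ι κ : Type*} (T : Matrix ι ι ℂ →ₗ[ℂ] Matrix ι ι ℂ)
    (S : Matrix κ κ ℂ →ₗ[ℂ] Matrix κ κ ℂ) (X : Matrix ι ι ℂ) (Y : Matrix κ κ ℂ) :
    tensorMap T S (X ⊗ₖ Y) = T X ⊗ₖ S Y := by
  ext p q
  have h1 : ∀ i i', (X ⊗ₖ Y).submatrix (Prod.mk i) (Prod.mk i') = X i i' • Y :=
    fun _ _ => rfl
  have h2 : (Matrix.of fun i i' => X i i' * S Y p.2 q.2) = S Y p.2 q.2 • X := by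
    ext i i'
    simp [mul_comm]
  simp [tensorMap, h1, h2, mul_comm]

/-- `T` is completely positive: `id ⊗ T` preserves positive semidefinite operators on
`ℂ^k ⊗ ℂ^ι` for every `k`. -/
def IsCompletelyPositive {ι : Type*} (T : Matrix ι ι ℂ →ₗ[ℂ] Matrix ι ι ℂ) : Prop :=
  ∀ (k : ℕ) (X : Matrix (Fin k × ι) (Fin k × ι) ℂ),
    X.PosSemidef → (tensorMap LinearMap.id T X).PosSemidef

/-- Quantum operations (channels) on `ℂ^ι`: completely positive trace-preserving linear maps. -/
structure IsQuantumOperation {ι : Type*} [Fintype ι]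
    (T : Matrix ι ι ℂ →ₗ[ℂ] Matrix ι ι ℂ) : Prop where
  completelyPositive : IsCompletelyPositive T
  trace_preserving : ∀ X, (T X).trace = X.trace

/-- The trace norm: the sum of the singular values. -/
noncomputable def traceNorm {ι : Type*} [Fintype ι] [DecidableEq ι] (M : Matrix ι ι ℂ) : ℝ :=
  (Matrix.toEuclideanLin M).singularValues.sum fun _ s => s

/-- The tensor power `A^{⊗ n}`, with `(ℂ^ι)^{⊗ n} = ℂ^(Fin n → ι)`. -/
def Matrix.tensorPow {ι : Type*} (A : Matrix ι ι ℂ) (n : ℕ) :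
    Matrix (Fin n → ι) (Fin n → ι) ℂ :=
  Matrix.of fun x y => ∏ k, A (x k) (y k)

/-! ## Rank-one quantum games -/

/-- A rank-one quantum game with question registers `A`, `B` and private referee register `C`:
the referee prepares the state `ψ` and finally measures with the projection `|γ⟩⟨γ|`. -/
structure RankOneGame (a b c : Type*) [Fintype a] [Fintype b] [Fintype c] where
  ψ : EuclideanSpace ℂ (a × b × c)
  γ : EuclideanSpace ℂ (a × b × c)
  norm_ψ : ‖ψ‖ = 1
  norm_γ : ‖γ‖ = 1

namespace RankOneGame

variable {a b c : Type*} [Fintype a] [Fintype b] [Fintype c]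
  [DecidableEq a] [DecidableEq b] [DecidableEq c]

/-- The operator `M_AB = tr_C |ψ⟩⟨γ|` on `ℂ^a ⊗ ℂ^b`. -/
def reduced (G : RankOneGame a b c) : Matrix (a × b) (a × b) ℂ :=
  Matrix.of fun p q => ∑ k, G.ψ (p.1, p.2, k) * star (G.γ (q.1, q.2, k))

/-- The map from operators on `ℂ^a` to operators on `ℂ^b` associated with `M_AB` through
`(∑ Aᵢ ⊗ Bᵢ)(X) = ∑ tr(Aᵢ Xᵀ) Bᵢ`. -/
def reducedMap (G : RankOneGame a b c) (X : Matrix a a ℂ) : Matrix b b ℂ :=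
  Matrix.of fun s v => ∑ r, ∑ u, G.reduced (r, s) (u, v) * X r u

/-- `G` is a Schur game with multiplier matrix `φ`: the map associated with `M_AB` is entrywise
multiplication by `φ`. -/
def IsSchurGameWith (G : RankOneGame a a c) (φ : Matrix a a ℂ) : Prop :=
  ∀ X : Matrix a a ℂ, G.reducedMap X = φ ⊙ X

/-- The maximal value `V(G) = ‖M_AB‖₁²`. -/
noncomputable def maximalValue (G : RankOneGame a b c) : ℝ :=
  traceNorm G.reduced ^ 2

/-- The pure state `|ψ⟩|ξ⟩`, where the players share the state `ξ` of `A'B'`; the registers are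
grouped as `(AA')(BB')C`. -/
def sharedInput (G : RankOneGame a b c) {a' b' : Type*} (ξ : EuclideanSpace ℂ (a' × b')) :
    (a × a') × (b × b') × c → ℂ :=
  fun p => G.ψ (p.1.1, p.2.1.1, p.2.2) * ξ (p.1.2, p.2.1.2)

/-- The winning projection `|γ⟩⟨γ|_{ABC} ⊗ 1_{A'B'}`, registers grouped as `(AA')(BB')C`. -/
def sharedProjection (G : RankOneGame a b c) (a' b' : Type*) [DecidableEq a'] [DecidableEq b'] :
    Matrix ((a × a') × (b × b') × c) ((a × a') × (b × b') × c) ℂ :=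
  Matrix.of fun p q =>
    if p.1.2 = q.1.2 ∧ p.2.1.2 = q.2.1.2 then
      G.γ (p.1.1, p.2.1.1, p.2.2) * star (G.γ (q.1.1, q.2.1.1, q.2.2))
    else 0

/-- The winning probability when Alice and Bob share `ξ` and apply the quantum operations `T` on
`AA'` and `S` on `BB'`. -/
def entangledWinProb (G : RankOneGame a b c) {a' b' : Type*} [Fintype a'] [Fintype b']
    [DecidableEq a'] [DecidableEq b'] (ξ : EuclideanSpace ℂ (a' × b'))
    (T : Matrix (a × a') (a × a') ℂ →ₗ[ℂ] Matrix (a × a') (a × a') ℂ)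
    (S : Matrix (b × b') (b × b') ℂ →ₗ[ℂ] Matrix (b × b') (b × b') ℂ) : ℝ :=
  (G.sharedProjection a' b' *
    tensorMap T (tensorMap S LinearMap.id)
      (Matrix.vecMulVec (G.sharedInput ξ) (star (G.sharedInput ξ)))).trace.re

/-- The winning probabilities of all strategies with finite-dimensional shared entanglement. -/
def entangledWinProbs (G : RankOneGame a b c) : Set ℝ :=
  {p | ∃ (m n : ℕ) (ξ : EuclideanSpace ℂ (Fin m × Fin n))
    (T : Matrix (a × Fin m) (a × Fin m) ℂ →ₗ[ℂ] Matrix (a × Fin m) (a × Fin m) ℂ)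
    (S : Matrix (b × Fin n) (b × Fin n) ℂ →ₗ[ℂ] Matrix (b × Fin n) (b × Fin n) ℂ),
    ‖ξ‖ = 1 ∧ IsQuantumOperation T ∧ IsQuantumOperation S ∧ p = G.entangledWinProb ξ T S}

/-- The entangled value `ω*(G)`. -/
noncomputable def entangledValue (G : RankOneGame a b c) : ℝ :=
  sSup G.entangledWinProbs

/-- The pure state `|ψ⟩|η⟩`, where a single player holding `A` and `B` also holds the state `η` of
an auxiliary register `E`; the registers are grouped as `(ABE)C`. -/
def singleInput (G : RankOneGame a b c) {e : Type*} (η : EuclideanSpace ℂ e) :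
    (a × b × e) × c → ℂ :=
  fun p => G.ψ (p.1.1, p.1.2.1, p.2) * η p.1.2.2

/-- The winning projection `|γ⟩⟨γ|_{ABC} ⊗ 1_E`, registers grouped as `(ABE)C`. -/
def singleProjection (G : RankOneGame a b c) (e : Type*) [DecidableEq e] :
    Matrix ((a × b × e) × c) ((a × b × e) × c) ℂ :=
  Matrix.of fun p q =>
    if p.1.2.2 = q.1.2.2 then
      G.γ (p.1.1, p.1.2.1, p.2) * star (G.γ (q.1.1, q.1.2.1, q.2))
    else 0

/-- The winning probability of a single player with access to both `A` and `B` who applies the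
quantum operation `W` on `ABE`. -/
def singleWinProb (G : RankOneGame a b c) {e : Type*} [Fintype e] [DecidableEq e]
    (η : EuclideanSpace ℂ e)
    (W : Matrix (a × b × e) (a × b × e) ℂ →ₗ[ℂ] Matrix (a × b × e) (a × b × e) ℂ) : ℝ :=
  (G.singleProjection e *
    tensorMap W LinearMap.id
      (Matrix.vecMulVec (G.singleInput η) (star (G.singleInput η)))).trace.re

/-- The winning probabilities of all strategies of a single player with access to both `A`
and `B`. -/
def singleWinProbs (G : RankOneGame a b c) : Set ℝ :=
  {p | ∃ (m : ℕ) (η : EuclideanSpace ℂ (Fin m))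
    (W : Matrix (a × b × Fin m) (a × b × Fin m) ℂ →ₗ[ℂ] Matrix (a × b × Fin m) (a × b × Fin m) ℂ),
    ‖η‖ = 1 ∧ IsQuantumOperation W ∧ p = G.singleWinProb η W}

end RankOneGame

/-! ## The games `A_n` -/

/-- The tensor power of a vector of `ℂ^a ⊗ ℂ^b ⊗ ℂ^c`, regrouped as a vector of
`(ℂ^a)^{⊗ n} ⊗ (ℂ^b)^{⊗ n} ⊗ (ℂ^c)^{⊗ n}`. -/
def tensorPowKet {a b c : Type*} (v : EuclideanSpace ℂ (a × b × c)) (n : ℕ) :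
    EuclideanSpace ℂ ((Fin n → a) × (Fin n → b) × (Fin n → c)) :=
  WithLp.toLp 2 fun p => ∏ k, v (p.1 k, p.2.1 k, p.2.2 k)

theorem norm_tensorPowKet {a b c : Type*} [Fintype a] [Fintype b] [Fintype c]
    (v : EuclideanSpace ℂ (a × b × c)) (n : ℕ) : ‖tensorPowKet v n‖ = ‖v‖ ^ n := by
  classical
  have h : ‖tensorPowKet v n‖ ^ 2 = (‖v‖ ^ n) ^ 2 := by
    rw [← pow_mul, mul_comm n 2, pow_mul, EuclideanSpace.norm_sq_eq, EuclideanSpace.norm_sq_eq]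
    have h1 : ∀ f : a × b × c → ℝ, (∑ i, f i) ^ n = ∑ p : Fin n → a × b × c, ∏ k, f (p k) := by
      intro f
      rw [← Fin.prod_const, Finset.prod_univ_sum, Fintype.piFinset_univ]
    rw [h1]
    refine Fintype.sum_equiv
      (((Equiv.refl _).prodCongr (Equiv.arrowProdEquivProdArrow (Fin n) (fun _ => b)
        (fun _ => c)).symm).trans
        (Equiv.arrowProdEquivProdArrow (Fin n) (fun _ => a) (fun _ => b × c)).symm) _ _ ?_
    intro p
    simp [tensorPowKet, norm_prod, Finset.prod_pow]
  exact (pow_left_inj₀ (norm_nonneg _) (by positivity) two_ne_zero).1 h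

/-- The basis vector `|i⟩_A |j⟩_B |k⟩_C` of three qubits. -/
noncomputable def ket (i j k : Fin 2) : EuclideanSpace ℂ (Fin 2 × Fin 2 × Fin 2) :=
  EuclideanSpace.single (i, j, k) 1

/-- The game `A_n`, with
`ψ_n = 2^{-n} ((|00⟩ + |11⟩)_{AB} |0⟩_C + (|00⟩ - |11⟩)_{AB} |1⟩_C)^{⊗ n}` and
`γ_n = 2^{-n/2} (|00⟩_{AB} |0⟩_C + |11⟩_{AB} |1⟩_C)^{⊗ n}`. -/
noncomputable def schurGame (n : ℕ) :
    RankOneGame (Fin n → Fin 2) (Fin n → Fin 2) (Fin n → Fin 2) where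
  ψ := (((2 : ℝ) ^ (-(n : ℝ)) : ℝ) : ℂ) •
    tensorPowKet ((ket 0 0 0 + ket 1 1 0) + (ket 0 0 1 - ket 1 1 1)) n
  γ := (((2 : ℝ) ^ (-(n : ℝ) / 2) : ℝ) : ℂ) • tensorPowKet (ket 0 0 0 + ket 1 1 1) n
  norm_ψ := by
    have h : ‖(ket 0 0 0 + ket 1 1 0) + (ket 0 0 1 - ket 1 1 1)‖ = 2 := by
      rw [EuclideanSpace.norm_eq, Real.sqrt_eq_iff_eq_sq (by positivity) (by norm_num)]
      simp [ket, Fintype.sum_prod_type, Fin.sum_univ_two]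
      norm_num
    rw [norm_smul, norm_tensorPowKet, h, Complex.norm_real,
      Real.norm_of_nonneg (by positivity), ← Real.rpow_natCast, ← Real.rpow_add (by norm_num)]
    simp
  norm_γ := by
    have h : ‖ket 0 0 0 + ket 1 1 1‖ = (2 : ℝ) ^ (1 / 2 : ℝ) := by
      rw [EuclideanSpace.norm_eq, ← Real.sqrt_eq_rpow]
      congr 1
      simp [ket, Fintype.sum_prod_type, Fin.sum_univ_two]
      norm_num
    rw [norm_smul, norm_tensorPowKet, h, Complex.norm_real,
      Real.norm_of_nonneg (by positivity), ← Real.rpow_natCast, ← Real.rpow_mul (by norm_num),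
      ← Real.rpow_add (by norm_num)]
    ring_nf
    simp

/-- The multiplier matrix `φ_n = 2^{-3n/2} A^{⊗ n}` with `A = [[1, 1], [1, -1]]`. -/
noncomputable def schurMatrix (n : ℕ) : Matrix (Fin n → Fin 2) (Fin n → Fin 2) ℂ :=
  (((2 : ℝ) ^ (-(3 * (n : ℝ) / 2)) : ℝ) : ℂ) • Matrix.tensorPow !![1, 1; 1, -1] n

/-! The success amplitude of a single player for one Kraus operator of the operation and one final
basis state of the auxiliary register is `tr (N * M_AB)`, where the matrices `N` satisfy
`∑ Nᴴ * N = 1`. For a polar decomposition `M_AB = W * P`, the Cauchy–Schwarz inequality for the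
form `(X, Y) ↦ tr (Y * P * Xᴴ)` bounds the winning probability by `‖M_AB‖₁ ^ 2`, and the
contraction `Wᴴ` attains this bound.

In a Schur game with multiplier matrix `φ` one has `M_AB = V * φ * Vᴴ`, where `V` is the isometry
`|i⟩ ↦ |ii⟩`; hence `V(G) = ‖φ‖₁ ^ 2`. The success amplitude of entangled players is then a sum
over one index of `ℂ^a`. By the Cauchy–Schwarz inequality over that index and the completeness of
the Kraus operators of Alice and of Bob, the winning probability is at most
`(dim ℂ^a * max |φ_xu|) ^ 2`. For `A_n` the matrix `φ_n` is `2 ^ (-n)` times a unitary matrix of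
size `2 ^ n`, so `‖φ_n‖₁ = 1`, while all its entries have modulus `2 ^ (-3n/2)`. -/

/-! ## The trace norm -/

section TraceNorm

open scoped MatrixOrder

variable {ι κ : Type*} [Fintype ι] [Fintype κ]

theorem exists_isHermitian_pseudoinverse {P : Matrix ι ι ℂ} (hP : P.IsHermitian) :
    ∃ Q : Matrix ι ι ℂ, Q.IsHermitian ∧ P * Q = Q * P ∧ P * Q * P = P := by
  classical
  have hcont (f : ℝ → ℝ) : ContinuousOn f (spectrum ℝ P) :=
    Matrix.finite_real_spectrum.continuousOn f
  have hid : cfc (fun x : ℝ => x) P = P := cfc_id' ℝ P hP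
  refine ⟨cfc (fun x : ℝ => x⁻¹) P, cfc_predicate _ P, ?_, ?_⟩
  · simpa only [hid] using (cfc_commute_cfc (fun x : ℝ => x) (fun x : ℝ => x⁻¹) P).eq
  · nth_rw 1 3 4 [← hid]
    rw [← cfc_mul _ _ P (hcont _) (hcont _), ← cfc_mul _ _ P (hcont _) (hcont _)]
    simp only [mul_inv_mul_cancel]

theorem exists_polarDecomposition (M : Matrix ι ι ℂ) :
    ∃ W P : Matrix ι ι ℂ, P.PosSemidef ∧ P * P = Mᴴ * M ∧ M = W * P ∧ Wᴴ * M = P ∧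
      IsIdempotentElem (W * Wᴴ) := by
  classical
  have hP : (CFC.abs M).PosSemidef := Matrix.nonneg_iff_posSemidef.1 (CFC.abs_nonneg M)
  have hPP : CFC.abs M * CFC.abs M = Mᴴ * M := CFC.abs_mul_abs M
  set P := CFC.abs M
  obtain ⟨Q, hQ, hcomm, hPQP⟩ := exists_isHermitian_pseudoinverse hP.1
  have hM : M = M * Q * P := by
    have hker : M * (1 - Q * P) = 0 := by
      rw [← Matrix.conjTranspose_mul_self_mul_eq_zero, ← hPP, Matrix.mul_assoc, mul_sub, mul_one,
        ← mul_assoc P Q P, hPQP, sub_self, mul_zero]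
    rwa [mul_sub, mul_one, sub_eq_zero, ← mul_assoc] at hker
  have hWM : (M * Q)ᴴ * M = P := by
    rw [Matrix.conjTranspose_mul, hQ.eq, mul_assoc, ← hPP, ← mul_assoc, ← hcomm, hPQP]
  refine ⟨M * Q, P, hP, hPP, hM, hWM, ?_⟩
  calc M * Q * (M * Q)ᴴ * (M * Q * (M * Q)ᴴ)
      = M * Q * ((M * Q)ᴴ * M) * Q * (M * Q)ᴴ := by simp only [mul_assoc]
    _ = M * Q * (M * Q)ᴴ := by rw [hWM, ← hM, mul_assoc]

theorem norm_sq_trace_mul_le {P : Matrix ι ι ℂ} (hP : P.PosSemidef) (A : Matrix ι ι ℂ) :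
    ‖(A * P).trace‖ ^ 2 ≤ P.trace.re * (A * P * Aᴴ).trace.re := by
  classical
  let _ := P.toMatrixSeminormedAddCommGroup hP
  let _ := P.toMatrixInnerProductSpace hP
  have hinner (X Y : Matrix ι ι ℂ) : inner ℂ X Y = (Y * P * Xᴴ).trace := rfl
  have h := norm_inner_le_norm (𝕜 := ℂ) (1 : Matrix ι ι ℂ) A
  have hsq (X : Matrix ι ι ℂ) : ‖X‖ ^ 2 = (X * P * Xᴴ).trace.re :=
    norm_sq_eq_re_inner (𝕜 := ℂ) X
  have := pow_le_pow_left₀ (norm_nonneg _) h 2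
  simpa [mul_pow, hsq, hinner] using this

variable [DecidableEq ι] [DecidableEq κ]

theorem traceNorm_eq_sum_sqrt_eigenvalues (M : Matrix ι ι ℂ) :
    traceNorm M =
      ∑ i, √((Matrix.isHermitian_conjTranspose_mul_self M).eigenvalues i) := by
  set T := Matrix.toEuclideanLin M with hT
  have hadj : LinearMap.adjoint T ∘ₗ T = Matrix.toEuclideanLin (Mᴴ * M) := by
    rw [hT, ← Matrix.toEuclideanLin_conjTranspose_eq_adjoint]
    ext v i
    simp [Matrix.toLpLin_apply]
  have hsupport : T.singularValues.support ⊆ Finset.range (Fintype.card ι) := fun i hi => by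
    by_contra hcard
    exact Finsupp.mem_support_iff.1 hi
      (T.singularValues_of_finrank_le (by simpa using hcard))
  rw [traceNorm, ← hT, Finsupp.sum_of_support_subset _ hsupport _ (by simp), Finset.sum_range]
  simp only [T.singularValues_fin finrank_euclideanSpace, Matrix.IsHermitian.eigenvalues,
    Matrix.IsHermitian.eigenvalues₀]
  simp only [hadj]
  exact (Equiv.sum_comp _ _).symm

theorem traceNorm_eq_trace_abs (M : Matrix ι ι ℂ) : (traceNorm M : ℂ) = (CFC.abs M).trace := by
  have hM := Matrix.posSemidef_conjTranspose_mul_self M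
  rw [traceNorm_eq_sum_sqrt_eigenvalues, CFC.abs, Matrix.star_eq_conjTranspose,
    CFC.sqrt_eq_real_sqrt _ hM.nonneg, cfcₙ_eq_cfc, hM.1.cfc_eq, Matrix.IsHermitian.cfc,
    Unitary.conjStarAlgAut_apply, Matrix.trace_mul_cycle]
  simp

theorem traceNorm_eq_trace_of_mul_self_eq {M P : Matrix ι ι ℂ} (hP : P.PosSemidef)
    (h : P * P = Mᴴ * M) : (traceNorm M : ℂ) = P.trace := by
  rw [traceNorm_eq_trace_abs, CFC.abs, Matrix.star_eq_conjTranspose,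
    CFC.sqrt_unique h hP.nonneg]

theorem sum_norm_sq_trace_mul_le_traceNorm_sq {ρ : Type*} [Fintype ρ] {N : ρ → Matrix ι ι ℂ}
    (hN : ∑ r, (N r)ᴴ * N r = 1) (M : Matrix ι ι ℂ) :
    ∑ r, ‖(N r * M).trace‖ ^ 2 ≤ traceNorm M ^ 2 := by
  obtain ⟨W, P, hP, hPP, hM, hWM, -⟩ := exists_polarDecomposition M
  have htrace : P.trace.re = traceNorm M := by
    rw [← traceNorm_eq_trace_of_mul_self_eq hP hPP, Complex.ofReal_re]
  have hsum : ∑ r, (N r * W * P * (N r * W)ᴴ).trace = P.trace := by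
    calc ∑ r, (N r * W * P * (N r * W)ᴴ).trace
        = ∑ r, ((N r)ᴴ * N r * (M * Wᴴ)).trace := by
          refine Finset.sum_congr rfl fun r _ => ?_
          rw [mul_assoc (N r), ← hM, Matrix.conjTranspose_mul, ← mul_assoc,
            Matrix.trace_mul_comm, mul_assoc, mul_assoc]
      _ = P.trace := by
          rw [← Matrix.trace_sum, ← Finset.sum_mul, hN, one_mul, Matrix.trace_mul_comm, hWM]
  calc ∑ r, ‖(N r * M).trace‖ ^ 2
      ≤ ∑ r, P.trace.re * (N r * W * P * (N r * W)ᴴ).trace.re := by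
        gcongr with r
        rw [hM, ← mul_assoc]
        exact norm_sq_trace_mul_le hP _
    _ = traceNorm M ^ 2 := by
        rw [← Finset.mul_sum, ← Complex.re_sum, hsum, htrace, sq]

theorem traceNorm_mul_mul_conjTranspose {V : Matrix κ ι ℂ} (hV : Vᴴ * V = 1)
    (φ : Matrix ι ι ℂ) : traceNorm (V * φ * Vᴴ) = traceNorm φ := by
  obtain ⟨-, P, hP, hPP, -⟩ := exists_polarDecomposition φ
  have hsq : V * P * Vᴴ * (V * P * Vᴴ) = (V * φ * Vᴴ)ᴴ * (V * φ * Vᴴ) := by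
    calc V * P * Vᴴ * (V * P * Vᴴ) = V * P * (Vᴴ * V) * P * Vᴴ := by
          simp only [Matrix.mul_assoc]
      _ = V * φᴴ * (Vᴴ * V) * φ * Vᴴ := by
          rw [hV, Matrix.mul_one, Matrix.mul_one, Matrix.mul_assoc V, hPP, ← Matrix.mul_assoc V]
      _ = (V * φ * Vᴴ)ᴴ * (V * φ * Vᴴ) := by
          simp only [Matrix.conjTranspose_mul, Matrix.conjTranspose_conjTranspose,
            Matrix.mul_assoc]
  apply Complex.ofReal_injective
  rw [traceNorm_eq_trace_of_mul_self_eq (hP.mul_mul_conjTranspose_same V) hsq,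
    traceNorm_eq_trace_of_mul_self_eq hP hPP, Matrix.trace_mul_cycle, hV, one_mul]

theorem traceNorm_of_conjTranspose_mul_self_eq_smul_one {M : Matrix ι ι ℂ} {r : ℝ} (hr : 0 ≤ r)
    (h : Mᴴ * M = (r ^ 2 : ℂ) • 1) : traceNorm M = r * Fintype.card ι := by
  have hP : ((r : ℂ) • (1 : Matrix ι ι ℂ)).PosSemidef :=
    Matrix.PosSemidef.one.smul (by exact_mod_cast hr)
  apply Complex.ofReal_injective
  rw [traceNorm_eq_trace_of_mul_self_eq hP (by simp only [h, smul_mul_smul_comm, mul_one, sq])]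
  simp

end TraceNorm

/-! ## Kraus decompositions -/

section KrausMap

variable {ι κ ρ τ : Type*} [Fintype ι] [Fintype κ] [Fintype ρ] [Fintype τ]

/-- The completely positive map `X ↦ ∑ᵣ Kᵣ X Kᵣᴴ` with Kraus operators `K`. -/
def krausMap (K : ρ → Matrix ι ι ℂ) : Matrix ι ι ℂ →ₗ[ℂ] Matrix ι ι ℂ where
  toFun X := ∑ r, K r * X * (K r)ᴴ
  map_add' X Y := by simp only [mul_add, add_mul, Finset.sum_add_distrib]
  map_smul' c X := by
    simp only [Matrix.mul_smul, Matrix.smul_mul, Finset.smul_sum, RingHom.id_apply]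

theorem krausMap_apply (K : ρ → Matrix ι ι ℂ) (X : Matrix ι ι ℂ) :
    krausMap K X = ∑ r, K r * X * (K r)ᴴ := rfl

theorem krausMap_one [DecidableEq ι] :
    krausMap (fun _ : Unit => (1 : Matrix ι ι ℂ)) = LinearMap.id := by
  ext1 X
  simp [krausMap_apply]

theorem krausMap_vecMulVec (K : ρ → Matrix ι ι ℂ) (v : ι → ℂ) :
    krausMap K (Matrix.vecMulVec v (star v)) =
      ∑ r, Matrix.vecMulVec (K r *ᵥ v) (star (K r *ᵥ v)) := by
  simp only [krausMap_apply, Matrix.mul_vecMulVec, Matrix.vecMulVec_mul, Matrix.star_mulVec]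

theorem posSemidef_krausMap (K : ρ → Matrix ι ι ℂ) {X : Matrix ι ι ℂ} (hX : X.PosSemidef) :
    (krausMap K X).PosSemidef :=
  Matrix.posSemidef_sum _ fun r _ => hX.mul_mul_conjTranspose_same (K r)

theorem trace_krausMap (K : ρ → Matrix ι ι ℂ) (X : Matrix ι ι ℂ) :
    (krausMap K X).trace = ((∑ r, (K r)ᴴ * K r) * X).trace := by
  rw [krausMap_apply, Matrix.trace_sum, Finset.sum_mul, Matrix.trace_sum]
  exact Finset.sum_congr rfl fun r _ => Matrix.trace_mul_cycle _ _ _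

theorem tensorMap_krausMap (K : ρ → Matrix ι ι ℂ)
    (L : τ → Matrix κ κ ℂ) :
    tensorMap (krausMap K) (krausMap L) = krausMap fun s : ρ × τ => K s.1 ⊗ₖ L s.2 := by
  classical
  refine Matrix.ext_linearMap ℂ fun i j => LinearMap.ext_ring ?_
  have hsingle : Matrix.single i j (1 : ℂ) =
      Matrix.single i.1 j.1 1 ⊗ₖ Matrix.single i.2 j.2 1 := by
    simp [Matrix.single_kronecker_single]
  rw [LinearMap.comp_apply, LinearMap.comp_apply, Matrix.singleLinearMap_apply, hsingle,
    tensorMap_kronecker]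
  simp only [krausMap_apply, Matrix.conjTranspose_kronecker, ← Matrix.mul_kronecker_mul,
    Fintype.sum_prod_type]
  ext p q
  simp [Matrix.sum_apply, Finset.sum_mul_sum]

theorem tensorMap_krausMap_id [DecidableEq κ] (K : ρ → Matrix ι ι ℂ) :
    tensorMap (krausMap K) (LinearMap.id : Matrix κ κ ℂ →ₗ[ℂ] Matrix κ κ ℂ) =
      krausMap fun r => K r ⊗ₖ (1 : Matrix κ κ ℂ) := by
  rw [← krausMap_one, tensorMap_krausMap]
  ext1 X
  simp [krausMap_apply, Fintype.sum_prod_type]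

theorem isCompletelyPositive_krausMap (K : ρ → Matrix ι ι ℂ) :
    IsCompletelyPositive (krausMap K) := by
  classical
  intro k X hX
  rw [← krausMap_one, tensorMap_krausMap]
  exact posSemidef_krausMap _ hX

theorem isQuantumOperation_krausMap [DecidableEq ι] {K : ρ → Matrix ι ι ℂ}
    (hK : ∑ r, (K r)ᴴ * K r = 1) : IsQuantumOperation (krausMap K) where
  completelyPositive := isCompletelyPositive_krausMap K
  trace_preserving X := by rw [trace_krausMap, hK, one_mul]

theorem sum_conjTranspose_submatrix_mul_submatrix [DecidableEq ι] [DecidableEq κ]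
    {K : ρ → Matrix ι ι ℂ} (hK : ∑ r, (K r)ᴴ * K r = 1) (E : κ ≃ ι) :
    ∑ r, ((K r).submatrix E E)ᴴ * (K r).submatrix E E = 1 := by
  simp only [Matrix.conjTranspose_submatrix, Matrix.submatrix_mul_equiv]
  rw [← Matrix.submatrix_one_equiv E, ← hK]
  ext p q
  simp only [Matrix.sum_apply, Matrix.submatrix_apply]

theorem IsCompletelyPositive.exists_krausMap {T : Matrix ι ι ℂ →ₗ[ℂ] Matrix ι ι ℂ}
    (hT : IsCompletelyPositive T) :
    ∃ (m : ℕ) (K : Fin m → Matrix ι ι ℂ), T = krausMap K := by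
  classical
  let f := Fintype.equivFin ι
  -- The Kraus operators are read off a decomposition of the Choi matrix `(id ⊗ T)(|ω⟩⟨ω|)`, where
  -- `ω` is the unnormalized maximally entangled vector.
  let ω : Fin (Fintype.card ι) × ι → ℂ := fun p => if p.1 = f p.2 then 1 else 0
  obtain ⟨m, v, hchoi⟩ := Matrix.posSemidef_iff_eq_sum_vecMulVec.1
    (hT _ _ (Matrix.posSemidef_vecMulVec_self_star ω))
  have hblock (i j : ι) : (Matrix.vecMulVec ω (star ω)).submatrix (Prod.mk (f i)) (Prod.mk (f j)) =
      Matrix.single i j 1 := by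
    ext k l
    simp only [ω, Matrix.submatrix_apply, Matrix.vecMulVec_apply, Matrix.single_apply,
      Pi.star_apply, f.injective.eq_iff]
    by_cases hk : i = k <;> by_cases hl : j = l <;> simp [hk, hl]
  have hT_single (i j p q : ι) : T (Matrix.single i j 1) p q =
      ∑ r, v r (f i, p) * star (v r (f j, q)) := by
    have h := congrFun (congrFun hchoi (f i, p)) (f j, q)
    simpa [tensorMap, hblock, Matrix.sum_apply, Matrix.vecMulVec_apply] using h
  refine ⟨m, fun r => Matrix.of fun p i => v r (f i, p),
    Matrix.ext_linearMap ℂ fun i j => LinearMap.ext_ring ?_⟩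
  ext p q
  rw [LinearMap.comp_apply, Matrix.singleLinearMap_apply, hT_single, LinearMap.comp_apply,
    Matrix.singleLinearMap_apply, krausMap_apply, Matrix.sum_apply]
  simp [Matrix.mul_apply, Matrix.single_apply, ite_and]

theorem IsQuantumOperation.exists_krausMap [DecidableEq ι]
    {T : Matrix ι ι ℂ →ₗ[ℂ] Matrix ι ι ℂ} (hT : IsQuantumOperation T) :
    ∃ (m : ℕ) (K : Fin m → Matrix ι ι ℂ), T = krausMap K ∧ ∑ r, (K r)ᴴ * K r = 1 := by
  obtain ⟨m, K, rfl⟩ := hT.completelyPositive.exists_krausMap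
  refine ⟨m, K, rfl, Matrix.ext_iff_trace_mul_right.2 fun X => ?_⟩
  rw [← trace_krausMap, hT.trace_preserving, one_mul]

theorem sum_norm_sq_mulVec [DecidableEq ι] {K : ρ → Matrix ι ι ℂ} (hK : ∑ r, (K r)ᴴ * K r = 1)
    (v : ι → ℂ) : ∑ r, ∑ p, ‖(K r *ᵥ v) p‖ ^ 2 = ∑ i, ‖v i‖ ^ 2 := by
  have hdot (w : ι → ℂ) : ((∑ i, ‖w i‖ ^ 2 : ℝ) : ℂ) = star w ⬝ᵥ w := by
    simp [dotProduct, Complex.conj_mul']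
  apply Complex.ofReal_injective
  rw [Complex.ofReal_sum]
  simp only [hdot, Matrix.star_mulVec]
  calc ∑ r, (star v ᵥ* (K r)ᴴ) ⬝ᵥ K r *ᵥ v = ∑ r, star v ⬝ᵥ ((K r)ᴴ * K r) *ᵥ v := by
        simp only [Matrix.dotProduct_mulVec, Matrix.vecMul_vecMul]
    _ = star v ⬝ᵥ v := by
        rw [← dotProduct_sum, ← Matrix.sum_mulVec, hK, Matrix.one_mulVec]

theorem trace_vecMulVec_kronecker_one_mul_vecMulVec {α β : Type*} [Fintype α] [Fintype β]
    [DecidableEq κ] (E : α ≃ β × κ) (g : β → ℂ) (w : α → ℂ) :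
    ((Matrix.vecMulVec g (star g) ⊗ₖ (1 : Matrix κ κ ℂ)).submatrix E E *
      Matrix.vecMulVec w (star w)).trace =
      ((∑ k, ‖∑ x, star (g x) * w (E.symm (x, k))‖ ^ 2 : ℝ) : ℂ) := by
  have hnorm (k : κ) : ((‖∑ x, star (g x) * w (E.symm (x, k))‖ ^ 2 : ℝ) : ℂ) =
      ∑ x, ∑ y, g x * star (g y) * (w (E.symm (y, k)) * star (w (E.symm (x, k)))) := by
    rw [Complex.ofReal_pow, ← Complex.conj_mul', map_sum, Finset.sum_mul_sum]
    refine Finset.sum_congr rfl fun x _ => Finset.sum_congr rfl fun y _ => ?_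
    simp only [map_mul, starRingEnd_apply, star_star]
    ring
  rw [Complex.ofReal_sum]
  simp only [hnorm, Matrix.trace, Matrix.diag, Matrix.mul_apply, Matrix.submatrix_apply]
  rw [← E.symm.sum_comp, Fintype.sum_prod_type, Finset.sum_comm]
  refine Finset.sum_congr rfl fun k _ => Finset.sum_congr rfl fun x _ => ?_
  rw [← E.symm.sum_comp, Fintype.sum_prod_type]
  simp [Matrix.vecMulVec_apply, Matrix.one_apply]

end KrausMap

section PartialMatrixElement

variable {ι ε ρ : Type*} [Fintype ι] [DecidableEq ι] [Fintype ε] [Fintype ρ]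

/-- The operator `1 ⊗ |η⟩ : ℂ^ι → ℂ^ι ⊗ ℂ^ε` adjoining an auxiliary register in the state `η`. -/
def adjoinState (ι : Type*) {ε : Type*} [DecidableEq ι] (η : ε → ℂ) : Matrix (ι × ε) ι ℂ :=
  Matrix.of fun p q => if p.1 = q then η p.2 else 0

/-- The operator `(1 ⊗ ⟨k|) K (1 ⊗ |η⟩)` on `ℂ^ι`: the effect of `K` when the auxiliary register
is prepared in the state `η` and found in the basis state `k`. -/
def partialMatrixElement (K : Matrix (ι × ε) (ι × ε) ℂ) (k : ε) (η : ε → ℂ) : Matrix ι ι ℂ :=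
  K.submatrix (·, k) id * adjoinState ι η

theorem partialMatrixElement_apply (K : Matrix (ι × ε) (ι × ε) ℂ) (k : ε) (η : ε → ℂ)
    (x y : ι) : partialMatrixElement K k η x y = ∑ l, K (x, k) (y, l) * η l := by
  simp [partialMatrixElement, adjoinState, Matrix.mul_apply, Fintype.sum_prod_type_right]

theorem adjoinState_conjTranspose_mul_self (η : ε → ℂ) :
    (adjoinState ι η)ᴴ * adjoinState ι η = (star η ⬝ᵥ η) • 1 := by
  ext x y
  simp [adjoinState, Matrix.mul_apply, Fintype.sum_prod_type_right, Matrix.one_apply, dotProduct,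
    apply_ite star, eq_comm]

theorem sum_conjTranspose_partialMatrixElement_mul_self [DecidableEq ε]
    {K : ρ → Matrix (ι × ε) (ι × ε) ℂ} (hK : ∑ r, (K r)ᴴ * K r = 1) (η : ε → ℂ) :
    ∑ r, ∑ k, (partialMatrixElement (K r) k η)ᴴ * partialMatrixElement (K r) k η =
      (star η ⬝ᵥ η) • 1 := by
  have hblocks (r : ρ) : ∑ k, ((K r).submatrix (·, k) id)ᴴ * (K r).submatrix (·, k) id =
      (K r)ᴴ * K r := by
    ext p q
    simp [Matrix.sum_apply, Matrix.mul_apply, Fintype.sum_prod_type_right]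
  calc _ = ∑ r, (adjoinState ι η)ᴴ * ((K r)ᴴ * K r) * adjoinState ι η := by
        simp only [← hblocks, partialMatrixElement, Matrix.conjTranspose_mul, Matrix.mul_sum,
          Matrix.sum_mul, Matrix.mul_assoc]
    _ = (star η ⬝ᵥ η) • 1 := by
        rw [← Matrix.sum_mul, ← Matrix.mul_sum, hK, Matrix.mul_one,
          adjoinState_conjTranspose_mul_self]

theorem sum_norm_sq_partialMatrixElement_apply [DecidableEq ε]
    {K : ρ → Matrix (ι × ε) (ι × ε) ℂ} (hK : ∑ r, (K r)ᴴ * K r = 1) (η : ε → ℂ) (y : ι) :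
    ∑ r, ∑ k, ∑ x, ‖partialMatrixElement (K r) k η x y‖ ^ 2 = ∑ l, ‖η l‖ ^ 2 := by
  have h := congrFun (congrFun (sum_conjTranspose_partialMatrixElement_mul_self hK η) y) y
  apply Complex.ofReal_injective
  simpa [Matrix.sum_apply, Matrix.mul_apply, dotProduct, Complex.conj_mul'] using h

end PartialMatrixElement

/-! ## Winning probabilities -/

theorem kronecker_one_mulVec_apply {ι κ : Type*} [Fintype ι] [Fintype κ] [DecidableEq κ]
    (K : Matrix ι ι ℂ) (w : ι × κ → ℂ) (x : ι) (z : κ) :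
    ((K ⊗ₖ (1 : Matrix κ κ ℂ)) *ᵥ w) (x, z) = (K *ᵥ fun y => w (y, z)) x := by
  simp [Matrix.mulVec, dotProduct, Fintype.sum_prod_type, Matrix.one_apply]

theorem partialMatrixElement_mulVec {ι ε : Type*} [Fintype ι] [DecidableEq ι] [Fintype ε]
    (K : Matrix (ι × ε) (ι × ε) ℂ) (k : ε) (η : ε → ℂ) (v : ι → ℂ) (x : ι) :
    (partialMatrixElement K k η *ᵥ v) x = (K *ᵥ fun p => v p.1 * η p.2) (x, k) := by
  simp only [Matrix.mulVec, dotProduct, partialMatrixElement_apply, Finset.sum_mul,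
    Fintype.sum_prod_type]
  refine Finset.sum_congr rfl fun y _ => Finset.sum_congr rfl fun l _ => ?_
  ring

namespace RankOneGame

section WinningProbabilities

variable {a b c : Type*} [Fintype a] [Fintype b] [Fintype c]

theorem sum_star_γ_mul_eq_trace_mul_reduced (G : RankOneGame a b c)
    (N : Matrix (a × b) (a × b) ℂ) :
    ∑ p, star (G.γ p) * (N *ᵥ fun q => G.ψ (q.1, q.2, p.2.2)) (p.1, p.2.1) =
      (N * G.reduced).trace := by
  simp only [Matrix.trace, Matrix.diag, Matrix.mul_apply, reduced, Matrix.of_apply, Matrix.mulVec,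
    dotProduct, Finset.mul_sum, Fintype.sum_prod_type]
  refine Finset.sum_congr rfl fun x _ => Finset.sum_congr rfl fun y _ => ?_
  rw [Finset.sum_comm]
  refine Finset.sum_congr rfl fun u _ => ?_
  rw [Finset.sum_comm]
  refine Finset.sum_congr rfl fun v _ => Finset.sum_congr rfl fun z _ => ?_
  ring

theorem entangledWinProbs_nonempty (G : RankOneGame a b c) : G.entangledWinProbs.Nonempty := by
  classical
  exact ⟨_, 1, 1, EuclideanSpace.single (0, 0) 1, _, _, by simp,
    isQuantumOperation_krausMap (K := fun _ : Unit => 1) (by simp),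
    isQuantumOperation_krausMap (K := fun _ : Unit => 1) (by simp), rfl⟩

variable [DecidableEq a] [DecidableEq b] {ρ τ : Type*} [Fintype ρ] [Fintype τ]

theorem singleWinProb_krausMap (G : RankOneGame a b c) {e : Type*} [Fintype e] [DecidableEq e]
    (η : EuclideanSpace ℂ e) (K : ρ → Matrix (a × b × e) (a × b × e) ℂ) :
    G.singleWinProb η (krausMap K) = ∑ r, ∑ k, ‖(partialMatrixElement
      ((K r).submatrix (Equiv.prodAssoc a b e) (Equiv.prodAssoc a b e)) k η *
        G.reduced).trace‖ ^ 2 := by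
  classical
  let E : (a × b × e) × c ≃ (a × b × c) × e :=
    { toFun := fun p => ((p.1.1, p.1.2.1, p.2), p.1.2.2)
      invFun := fun p => ((p.1.1, p.1.2.1, p.2), p.1.2.2) }
  have hprojection : G.singleProjection e =
      (Matrix.vecMulVec G.γ (star G.γ) ⊗ₖ (1 : Matrix e e ℂ)).submatrix E E := by
    ext p q
    simp [singleProjection, E, Matrix.vecMulVec_apply, Matrix.one_apply]
  rw [singleWinProb, tensorMap_krausMap_id, krausMap_vecMulVec, Finset.mul_sum, Matrix.trace_sum,
    Complex.re_sum]
  refine Finset.sum_congr rfl fun r _ => ?_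
  rw [hprojection, trace_vecMulVec_kronecker_one_mul_vecMulVec, Complex.ofReal_re]
  refine Finset.sum_congr rfl fun k _ => ?_
  rw [← sum_star_γ_mul_eq_trace_mul_reduced]
  simp only [partialMatrixElement_mulVec, Matrix.submatrix_mulVec_equiv]
  simp only [E, Equiv.coe_fn_symm_mk, kronecker_one_mulVec_apply]
  rfl

theorem entangledWinProb_krausMap (G : RankOneGame a b c) {a' b' : Type*} [Fintype a']
    [Fintype b'] [DecidableEq a'] [DecidableEq b'] (ξ : EuclideanSpace ℂ (a' × b'))
    (K : ρ → Matrix (a × a') (a × a') ℂ) (L : τ → Matrix (b × b') (b × b') ℂ) :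
    G.entangledWinProb ξ (krausMap K) (krausMap L) = ∑ r, ∑ t, ∑ k,
      ‖(partialMatrixElement ((K r ⊗ₖ L t).submatrix (Equiv.prodProdProdComm a b a' b')
        (Equiv.prodProdProdComm a b a' b')) k ξ * G.reduced).trace‖ ^ 2 := by
  classical
  let E : (a × a') × (b × b') × c ≃ (a × b × c) × (a' × b') :=
    { toFun := fun p => ((p.1.1, p.2.1.1, p.2.2), p.1.2, p.2.1.2)
      invFun := fun p => ((p.1.1, p.2.1), (p.1.2.1, p.2.2), p.1.2.2) }
  have hprojection : G.sharedProjection a' b' =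
      (Matrix.vecMulVec G.γ (star G.γ) ⊗ₖ (1 : Matrix (a' × b') (a' × b') ℂ)).submatrix E E := by
    ext p q
    simp [sharedProjection, E, Matrix.vecMulVec_apply, Matrix.one_apply]
  have hmulVec (M : Matrix (a × a') (a × a') ℂ) (N : Matrix (b × b') (b × b') ℂ)
      (w : (a × a') × (b × b') × c → ℂ) (x y z) :
      ((M ⊗ₖ (N ⊗ₖ (1 : Matrix c c ℂ))) *ᵥ w) (x, y, z) =
        ((M ⊗ₖ N) *ᵥ fun s => w (s.1, s.2, z)) (x, y) := by
    rw [← Matrix.kronecker_assoc', Matrix.submatrix_mulVec_equiv]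
    exact kronecker_one_mulVec_apply _ _ _ _
  rw [entangledWinProb, tensorMap_krausMap_id, tensorMap_krausMap, krausMap_vecMulVec,
    Finset.mul_sum, Matrix.trace_sum, Complex.re_sum, Fintype.sum_prod_type]
  refine Finset.sum_congr rfl fun r _ => Finset.sum_congr rfl fun t _ => ?_
  rw [hprojection, trace_vecMulVec_kronecker_one_mul_vecMulVec, Complex.ofReal_re]
  refine Finset.sum_congr rfl fun k _ => ?_
  rw [← sum_star_γ_mul_eq_trace_mul_reduced]
  simp only [partialMatrixElement_mulVec, Matrix.submatrix_mulVec_equiv]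
  simp only [E, Equiv.coe_fn_symm_mk, hmulVec]
  rfl

end WinningProbabilities

section SinglePlayer

variable {a b c : Type*} [Fintype a] [Fintype b] [Fintype c]
  [DecidableEq a] [DecidableEq b]

theorem singleWinProb_le_maximalValue (G : RankOneGame a b c) {e : Type*} [Fintype e]
    [DecidableEq e] {η : EuclideanSpace ℂ e} (hη : ‖η‖ = 1)
    {T : Matrix (a × b × e) (a × b × e) ℂ →ₗ[ℂ] Matrix (a × b × e) (a × b × e) ℂ}
    (hT : IsQuantumOperation T) : G.singleWinProb η T ≤ G.maximalValue := by
  obtain ⟨m, K, rfl, hK⟩ := hT.exists_krausMap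
  have hη' : star (η : e → ℂ) ⬝ᵥ (η : e → ℂ) = 1 := by
    rw [dotProduct_comm, ← EuclideanSpace.inner_eq_star_dotProduct, inner_self_eq_norm_sq_to_K, hη]
    simp
  have hcomplete := sum_conjTranspose_partialMatrixElement_mul_self
    (sum_conjTranspose_submatrix_mul_submatrix hK (Equiv.prodAssoc a b e)) η
  rw [hη', one_smul, ← Fintype.sum_prod_type'] at hcomplete
  rw [singleWinProb_krausMap, ← Fintype.sum_prod_type']
  exact sum_norm_sq_trace_mul_le_traceNorm_sq hcomplete _

theorem exists_maximalValue_le_singleWinProb (G : RankOneGame a b c) :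
    ∃ p ∈ G.singleWinProbs, G.maximalValue ≤ p := by
  obtain ⟨W, P, hP, hPP, -, hWM, hproj⟩ := exists_polarDecomposition G.reduced
  let E : a × b × Fin 1 ≃ a × b := (Equiv.prodAssoc a b (Fin 1)).symm.trans (Equiv.prodUnique _ _)
  -- `Wᴴ` attains the maximal value, and `1 - W * Wᴴ` completes it to a quantum operation.
  let K : Fin 2 → Matrix (a × b) (a × b) ℂ := ![Wᴴ, 1 - W * Wᴴ]
  have hK : ∑ r, (K r)ᴴ * K r = 1 := by
    have hself : (1 - W * Wᴴ)ᴴ = 1 - W * Wᴴ :=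
      Matrix.isHermitian_one.sub (Matrix.isHermitian_mul_conjTranspose_self W)
    rw [Fin.sum_univ_two]
    simp only [K, Matrix.cons_val_zero, Matrix.cons_val_one, Matrix.conjTranspose_conjTranspose,
      hself, hproj.one_sub.eq, add_sub_cancel]
  refine ⟨_, ⟨1, EuclideanSpace.single 0 1, krausMap fun r => (K r).submatrix E E, by simp,
    isQuantumOperation_krausMap (sum_conjTranspose_submatrix_mul_submatrix hK E), rfl⟩, ?_⟩
  have helement (N : Matrix (a × b) (a × b) ℂ) : partialMatrixElement
      ((N.submatrix E E).submatrix (Equiv.prodAssoc a b (Fin 1)) (Equiv.prodAssoc a b (Fin 1))) 0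
        (EuclideanSpace.single (0 : Fin 1) (1 : ℂ)) = N := by
    ext x y
    simp [partialMatrixElement_apply, E]
  have htrace : (Wᴴ * G.reduced).trace = traceNorm G.reduced := by
    rw [hWM, traceNorm_eq_trace_of_mul_self_eq hP hPP]
  rw [singleWinProb_krausMap, Fin.sum_univ_two]
  simp only [Fin.sum_univ_one, helement, K, Matrix.cons_val_zero, Matrix.cons_val_one, htrace]
  rw [Complex.norm_real, Real.norm_eq_abs, sq_abs, maximalValue]
  exact le_add_of_nonneg_right (sq_nonneg _)

theorem isLUB_singleWinProbs (G : RankOneGame a b c) :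
    IsLUB G.singleWinProbs G.maximalValue := by
  refine ⟨?_, fun q hq => ?_⟩
  · rintro _ ⟨m, η, T, hη, hT, rfl⟩
    exact G.singleWinProb_le_maximalValue hη hT
  · obtain ⟨p, hp, hle⟩ := G.exists_maximalValue_le_singleWinProb
    exact hle.trans (hq hp)

end SinglePlayer
end RankOneGame

/-! ## Schur games -/

section DiagonalIsometry

variable {a : Type*} [Fintype a] [DecidableEq a]

/-- The isometry `|i⟩ ↦ |ii⟩` from `ℂ^a` to `ℂ^a ⊗ ℂ^a`; conjugation by it embeds the matrices on
`ℂ^a` as the operators supported on the diagonal basis states. -/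
def diagonalIsometry (a : Type*) [DecidableEq a] : Matrix (a × a) a ℂ :=
  Matrix.of fun p i => if p = (i, i) then 1 else 0

theorem diagonalIsometry_conjTranspose_mul_self :
    (diagonalIsometry a)ᴴ * diagonalIsometry a = 1 := by
  ext i j
  simp [diagonalIsometry, Matrix.mul_apply, Matrix.one_apply, apply_ite star, eq_comm]

theorem diagonalIsometry_mul_mul_conjTranspose_apply (φ : Matrix a a ℂ) (r s u v : a) :
    (diagonalIsometry a * φ * (diagonalIsometry a)ᴴ) (r, s) (u, v) =
      if s = r ∧ v = u then φ r u else 0 := by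
  have hket (w : a → ℂ) :
      ∑ i, diagonalIsometry a (r, s) i * w i = if s = r then w r else 0 := by
    simp [diagonalIsometry, ite_and]
  have hbra (w : a → ℂ) :
      ∑ i, w i * (diagonalIsometry a)ᴴ i (u, v) = if v = u then w u else 0 := by
    simp [diagonalIsometry, ite_and, apply_ite star]
  simp only [Matrix.mul_apply (M := diagonalIsometry a * φ), Matrix.mul_apply (N := φ), hket, hbra]
  split_ifs <;> simp_all

theorem trace_mul_diagonalIsometry_mul_mul_conjTranspose (N : Matrix (a × a) (a × a) ℂ)
    (φ : Matrix a a ℂ) : (N * (diagonalIsometry a * φ * (diagonalIsometry a)ᴴ)).trace =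
      ∑ u, ∑ x, N (u, u) (x, x) * φ x u := by
  simp only [Matrix.trace, Matrix.diag]
  simp [Matrix.mul_apply (M := N), Fintype.sum_prod_type,
    diagonalIsometry_mul_mul_conjTranspose_apply, ite_and]

end DiagonalIsometry

theorem sum_norm_sq_sum_mulVec_le {ι ε ρ : Type*} [Fintype ι] [Fintype ε] [Fintype ρ]
    [DecidableEq ι] [DecidableEq ε] {K : ρ → Matrix (ι × ε) (ι × ε) ℂ}
    (hK : ∑ r, (K r)ᴴ * K r = 1) (v : ι → ι × ε → ℂ) :
    ∑ r, ∑ k, ‖∑ x, (K r *ᵥ v x) (x, k)‖ ^ 2 ≤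
      Fintype.card ι * ∑ x, ∑ p, ‖v x p‖ ^ 2 := by
  have hcauchySchwarz (f : ι → ℂ) : ‖∑ x, f x‖ ^ 2 ≤ Fintype.card ι * ∑ x, ‖f x‖ ^ 2 :=
    calc ‖∑ x, f x‖ ^ 2 ≤ (∑ x, ‖f x‖) ^ 2 := by gcongr; exact norm_sum_le _ _
      _ ≤ _ := by simpa using sq_sum_le_card_mul_sum_sq (s := Finset.univ) (f := fun x => ‖f x‖)
  calc ∑ r, ∑ k, ‖∑ x, (K r *ᵥ v x) (x, k)‖ ^ 2
      ≤ ∑ r, ∑ k, Fintype.card ι * ∑ x, ‖(K r *ᵥ v x) (x, k)‖ ^ 2 := by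
        gcongr
        exact hcauchySchwarz _
    _ = Fintype.card ι * ∑ x, ∑ r, ∑ k, ‖(K r *ᵥ v x) (x, k)‖ ^ 2 := by
        simp only [← Finset.mul_sum]
        rw [Finset.sum_comm (s := (Finset.univ : Finset ι))]
        congr! 2 with r
        exact Finset.sum_comm
    _ ≤ Fintype.card ι * ∑ x, ∑ r, ∑ p, ‖(K r *ᵥ v x) p‖ ^ 2 := by
        gcongr with x _ r
        rw [Fintype.sum_prod_type]
        exact Finset.single_le_sum (f := fun y => ∑ k, ‖(K r *ᵥ v x) (y, k)‖ ^ 2)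
          (fun y _ => by positivity) (Finset.mem_univ x)
    _ = Fintype.card ι * ∑ x, ∑ p, ‖v x p‖ ^ 2 := by
        simp only [sum_norm_sq_mulVec hK]

theorem sum_norm_sq_mul_partialMatrixElement_le {ι ε δ ρ : Type*} [Fintype ι] [Fintype ε]
    [Fintype δ] [Fintype ρ] [DecidableEq ι] [DecidableEq ε] {L : ρ → Matrix (ι × ε) (ι × ε) ℂ}
    (hL : ∑ r, (L r)ᴴ * L r = 1) {φ : Matrix ι ι ℂ} {B : ℝ} (hφ : ∀ x u, ‖φ x u‖ ≤ B)
    (ξ : δ × ε → ℂ) :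
    ∑ r, ∑ j, ∑ u, ∑ p : ι × δ,
        ‖φ p.1 u * partialMatrixElement (L r) j (fun l => ξ (p.2, l)) u p.1‖ ^ 2 ≤
      B ^ 2 * Fintype.card ι * ∑ s, ‖ξ s‖ ^ 2 := by
  calc _ ≤ ∑ r, ∑ j, ∑ u, ∑ p : ι × δ,
            B ^ 2 * ‖partialMatrixElement (L r) j (fun l => ξ (p.2, l)) u p.1‖ ^ 2 := by
          gcongr with r _ j _ u _ p
          rw [norm_mul, mul_pow]
          gcongr
          exact hφ _ _
    _ = B ^ 2 * ∑ p : ι × δ, ∑ r, ∑ j, ∑ u,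
            ‖partialMatrixElement (L r) j (fun l => ξ (p.2, l)) u p.1‖ ^ 2 := by
          simp only [← Finset.mul_sum]
          rw [Finset.sum_comm (s := (Finset.univ : Finset (ι × δ)))]
          congr! 2 with r
          rw [Finset.sum_comm (s := (Finset.univ : Finset (ι × δ)))]
          congr! 1 with j
          exact Finset.sum_comm
    _ = B ^ 2 * Fintype.card ι * ∑ s, ‖ξ s‖ ^ 2 := by
          simp [sum_norm_sq_partialMatrixElement_apply hL, Fintype.sum_prod_type, mul_assoc]

namespace RankOneGame

section SchurGames

variable {a c : Type*} [Fintype a] [Fintype c]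

theorem isSchurGameWith_iff_reduced_eq [DecidableEq a] {G : RankOneGame a a c}
    {φ : Matrix a a ℂ} :
    G.IsSchurGameWith φ ↔ G.reduced = diagonalIsometry a * φ * (diagonalIsometry a)ᴴ := by
  refine ⟨fun hG => ?_, fun hG X => ?_⟩
  · ext ⟨r, s⟩ ⟨u, v⟩
    have h := congrFun (congrFun (hG (Matrix.single r u 1)) s) v
    simp only [reducedMap, Matrix.of_apply, Matrix.single_apply, Matrix.hadamard_apply, mul_ite,
      mul_one, mul_zero, ite_and, Finset.sum_ite_eq, Finset.mem_univ, if_true,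
      Finset.sum_ite_irrel, Finset.sum_const_zero] at h
    rw [h, diagonalIsometry_mul_mul_conjTranspose_apply]
    by_cases hrs : s = r <;> by_cases huv : v = u <;> simp [hrs, huv, Ne.symm]
  · ext s v
    simp [reducedMap, hG, diagonalIsometry_mul_mul_conjTranspose_apply, ite_and]

theorem IsSchurGameWith.maximalValue_eq [DecidableEq a] {G : RankOneGame a a c}
    {φ : Matrix a a ℂ} (hG : G.IsSchurGameWith φ) : G.maximalValue = traceNorm φ ^ 2 := by
  rw [maximalValue, isSchurGameWith_iff_reduced_eq.1 hG,
    traceNorm_mul_mul_conjTranspose diagonalIsometry_conjTranspose_mul_self]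

variable {a' b' ρ τ : Type*} [Fintype a'] [Fintype b'] [Fintype ρ] [Fintype τ]

theorem IsSchurGameWith.trace_partialMatrixElement_kronecker_mul_reduced [DecidableEq a]
    {G : RankOneGame a a c} {φ : Matrix a a ℂ} (hG : G.IsSchurGameWith φ) (ξ : a' × b' → ℂ)
    (K : Matrix (a × a') (a × a') ℂ) (L : Matrix (a × b') (a × b') ℂ) (i : a') (j : b') :
    (partialMatrixElement ((K ⊗ₖ L).submatrix (Equiv.prodProdProdComm a a a' b')
      (Equiv.prodProdProdComm a a a' b')) (i, j) ξ * G.reduced).trace =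
      ∑ u, (K *ᵥ fun p => φ p.1 u * partialMatrixElement L j (fun l => ξ (p.2, l)) u p.1)
        (u, i) := by
  rw [isSchurGameWith_iff_reduced_eq.1 hG, trace_mul_diagonalIsometry_mul_mul_conjTranspose]
  simp only [partialMatrixElement_apply, Matrix.mulVec, dotProduct, Fintype.sum_prod_type,
    Finset.mul_sum, Finset.sum_mul, Matrix.submatrix_apply, Matrix.kroneckerMap_apply,
    Equiv.prodProdProdComm_apply]
  congr! 4
  ring

theorem IsSchurGameWith.entangledWinProb_le [DecidableEq a'] [DecidableEq b']
    {G : RankOneGame a a c} {φ : Matrix a a ℂ} (hG : G.IsSchurGameWith φ) {B : ℝ}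
    (hφ : ∀ x u, ‖φ x u‖ ≤ B) {ξ : EuclideanSpace ℂ (a' × b')} (hξ : ‖ξ‖ = 1)
    {T : Matrix (a × a') (a × a') ℂ →ₗ[ℂ] Matrix (a × a') (a × a') ℂ}
    {S : Matrix (a × b') (a × b') ℂ →ₗ[ℂ] Matrix (a × b') (a × b') ℂ}
    (hT : IsQuantumOperation T) (hS : IsQuantumOperation S) :
    G.entangledWinProb ξ T S ≤ (B * Fintype.card a) ^ 2 := by
  classical
  obtain ⟨m, K, rfl, hK⟩ := hT.exists_krausMap
  obtain ⟨n, L, rfl, hL⟩ := hS.exists_krausMap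
  let v (t : Fin n) (j : b') (u : a) (p : a × a') : ℂ :=
    φ p.1 u * partialMatrixElement (L t) j (fun l => ξ (p.2, l)) u p.1
  have hBob : ∑ t, ∑ j, ∑ u, ∑ p, ‖v t j u p‖ ^ 2 ≤ B ^ 2 * Fintype.card a := by
    simpa [v, ← EuclideanSpace.norm_sq_eq, hξ] using
      sum_norm_sq_mul_partialMatrixElement_le hL hφ ξ
  calc G.entangledWinProb ξ (krausMap K) (krausMap L)
      = ∑ t, ∑ j, ∑ r, ∑ i, ‖∑ u, (K r *ᵥ v t j u) (u, i)‖ ^ 2 := by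
        simp only [entangledWinProb_krausMap, Fintype.sum_prod_type,
          hG.trace_partialMatrixElement_kronecker_mul_reduced]
        rw [Finset.sum_comm]
        congr! 1 with t
        rw [Finset.sum_comm (s := (Finset.univ : Finset b'))]
        congr! 1 with r
        exact Finset.sum_comm
    _ ≤ ∑ t, ∑ j, Fintype.card a * ∑ u, ∑ p, ‖v t j u p‖ ^ 2 := by
        gcongr
        exact sum_norm_sq_sum_mulVec_le hK _
    _ ≤ Fintype.card a * (B ^ 2 * Fintype.card a) := by
        simp only [← Finset.mul_sum]
        gcongr
    _ = (B * Fintype.card a) ^ 2 := by ring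

end SchurGames
end RankOneGame

/-! ## Values of the games `A_n` -/

theorem tensorPow_mul_tensorPow {ι : Type*} [Fintype ι] (A B : Matrix ι ι ℂ) (n : ℕ) :
    A.tensorPow n * B.tensorPow n = (A * B).tensorPow n := by
  ext x y
  simp only [Matrix.tensorPow, Matrix.mul_apply, Matrix.of_apply, ← Finset.prod_mul_distrib,
    Finset.prod_univ_sum, Fintype.piFinset_univ]

theorem tensorPow_smul_one {ι : Type*} [DecidableEq ι] (z : ℂ) (n : ℕ) :
    (z • (1 : Matrix ι ι ℂ)).tensorPow n = z ^ n • 1 := by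
  ext x y
  simp [Matrix.tensorPow, Matrix.one_apply, Finset.prod_ite_zero, funext_iff]

theorem conjTranspose_tensorPow {ι : Type*} (A : Matrix ι ι ℂ) (n : ℕ) :
    (A.tensorPow n)ᴴ = Aᴴ.tensorPow n := by
  ext x y
  simp [Matrix.tensorPow]

theorem norm_tensorPow_apply_of_norm_apply_eq_one {ι : Type*} {A : Matrix ι ι ℂ}
    (hA : ∀ i j, ‖A i j‖ = 1) (n : ℕ) (x y : Fin n → ι) : ‖A.tensorPow n x y‖ = 1 := by
  simp [Matrix.tensorPow, hA]

theorem two_rpow_neg_mul_two_rpow_neg_half (t : ℝ) :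
    (2 : ℝ) ^ (-t) * 2 ^ (-t / 2) = 2 ^ (-(3 * t / 2)) := by
  rw [← Real.rpow_add two_pos]
  ring_nf

theorem two_rpow_neg_three_halves_sq_mul_two_pow (n : ℕ) :
    ((2 : ℝ) ^ (-(3 * (n : ℝ) / 2))) ^ 2 * 2 ^ n = ((2 : ℝ) ^ (-(n : ℝ))) ^ 2 := by
  simp only [← Real.rpow_natCast, ← Real.rpow_mul zero_le_two, ← Real.rpow_add two_pos]
  push_cast
  ring_nf

theorem two_rpow_neg_mul_two_pow (n : ℕ) : (2 : ℝ) ^ (-(n : ℝ)) * 2 ^ n = 1 := by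
  rw [← Real.rpow_natCast, ← Real.rpow_add two_pos, neg_add_cancel, Real.rpow_zero]

section SchurGame

variable (n : ℕ)

theorem schurGame_ψ_apply (x y z : Fin n → Fin 2) : (schurGame n).ψ (x, y, z) =
    if y = x then (((2 : ℝ) ^ (-(n : ℝ)) : ℝ) : ℂ) * Matrix.tensorPow !![1, 1; 1, -1] n x z
    else 0 := by
  have h (i j k : Fin 2) : ((ket 0 0 0 + ket 1 1 0) + (ket 0 0 1 - ket 1 1 1)) (i, j, k) =
      if j = i then !![(1 : ℂ), 1; 1, -1] i k else 0 := by
    fin_cases i <;> fin_cases j <;> fin_cases k <;> simp [ket]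
  simp only [schurGame, tensorPowKet, PiLp.smul_apply, smul_eq_mul, h, Finset.prod_ite_zero]
  simp [funext_iff, Matrix.tensorPow]

theorem schurGame_γ_apply (x y z : Fin n → Fin 2) : (schurGame n).γ (x, y, z) =
    if y = x ∧ z = x then (((2 : ℝ) ^ (-(n : ℝ) / 2) : ℝ) : ℂ) else 0 := by
  have h (i j k : Fin 2) : (ket 0 0 0 + ket 1 1 1) (i, j, k) =
      if j = i ∧ k = i then (1 : ℂ) else 0 := by
    fin_cases i <;> fin_cases j <;> fin_cases k <;> simp [ket]
  simp only [schurGame, tensorPowKet, PiLp.smul_apply, smul_eq_mul, h, Finset.prod_ite_zero]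
  simp [funext_iff, forall_and]

theorem schurGame_reduced_apply (r s u v : Fin n → Fin 2) :
    (schurGame n).reduced (r, s) (u, v) = if s = r ∧ v = u then schurMatrix n r u else 0 := by
  simp only [RankOneGame.reduced, Matrix.of_apply, schurGame_ψ_apply, schurGame_γ_apply,
    schurMatrix, Matrix.smul_apply, smul_eq_mul, ← two_rpow_neg_mul_two_rpow_neg_half]
  by_cases hrs : s = r <;> by_cases huv : v = u <;>
    simp [hrs, huv, apply_ite (starRingEnd ℂ), mul_right_comm]

theorem isSchurGameWith_schurGame : (schurGame n).IsSchurGameWith (schurMatrix n) := by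
  rw [RankOneGame.isSchurGameWith_iff_reduced_eq]
  ext ⟨r, s⟩ ⟨u, v⟩
  rw [schurGame_reduced_apply, diagonalIsometry_mul_mul_conjTranspose_apply]

theorem norm_schurMatrix_apply (x y : Fin n → Fin 2) :
    ‖schurMatrix n x y‖ = (2 : ℝ) ^ (-(3 * (n : ℝ) / 2)) := by
  have hsign (i j : Fin 2) : ‖!![(1 : ℂ), 1; 1, -1] i j‖ = 1 := by
    fin_cases i <;> fin_cases j <;> simp
  rw [schurMatrix, Matrix.smul_apply, norm_smul, norm_tensorPow_apply_of_norm_apply_eq_one hsign,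
    Complex.norm_real, Real.norm_of_nonneg (by positivity), mul_one]

theorem schurMatrix_conjTranspose_mul_self :
    (schurMatrix n)ᴴ * schurMatrix n = ((((2 : ℝ) ^ (-(n : ℝ)) : ℝ) : ℂ) ^ 2) • 1 := by
  have hHadamard : !![(1 : ℂ), 1; 1, -1]ᴴ * !![1, 1; 1, -1] = (2 : ℂ) • 1 := by
    ext i j
    fin_cases i <;> fin_cases j <;> norm_num [Matrix.mul_apply, Fin.sum_univ_two]
  rw [schurMatrix, Matrix.conjTranspose_smul, Matrix.smul_mul, Matrix.mul_smul,
    conjTranspose_tensorPow, tensorPow_mul_tensorPow, hHadamard, tensorPow_smul_one, smul_smul,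
    smul_smul, Complex.star_def, Complex.conj_ofReal, ← pow_two]
  congr 1
  exact_mod_cast two_rpow_neg_three_halves_sq_mul_two_pow n

theorem traceNorm_schurMatrix : traceNorm (schurMatrix n) = 1 := by
  rw [traceNorm_of_conjTranspose_mul_self_eq_smul_one (by positivity)
    (schurMatrix_conjTranspose_mul_self n)]
  simp

theorem maximalValue_schurGame : (schurGame n).maximalValue = 1 := by
  rw [(isSchurGameWith_schurGame n).maximalValue_eq, traceNorm_schurMatrix, one_pow]

theorem le_of_mem_entangledWinProbs_schurGame {p : ℝ} (hp : p ∈ (schurGame n).entangledWinProbs) :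
    p ≤ (2 : ℝ) ^ (-(n : ℝ)) := by
  obtain ⟨k, l, ξ, T, S, hξ, hT, hS, rfl⟩ := hp
  calc (schurGame n).entangledWinProb ξ T S
      ≤ ((2 : ℝ) ^ (-(3 * (n : ℝ) / 2)) * Fintype.card (Fin n → Fin 2)) ^ 2 :=
        (isSchurGameWith_schurGame n).entangledWinProb_le
          (fun x u => (norm_schurMatrix_apply n x u).le) hξ hT hS
    _ = ((2 : ℝ) ^ (-(3 * (n : ℝ) / 2))) ^ 2 * 2 ^ n * 2 ^ n := by
        rw [Fintype.card_fun, Fintype.card_fin, Fintype.card_fin]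
        push_cast
        ring
    _ = (2 : ℝ) ^ (-(n : ℝ)) := by
        rw [two_rpow_neg_three_halves_sq_mul_two_pow, pow_two, mul_assoc,
          two_rpow_neg_mul_two_pow, mul_one]

end SchurGame

theorem mainTheorem10 (n : ℕ) :
    (schurGame n).IsSchurGameWith (schurMatrix n) ∧
    (schurGame n).maximalValue = 1 ∧
    IsLUB (schurGame n).singleWinProbs 1 ∧
    IsLUB (schurGame n).entangledWinProbs (schurGame n).entangledValue ∧
    (schurGame n).entangledValue ≤ (2 : ℝ) ^ (-(n : ℝ)) := by
  have hnonempty := (schurGame n).entangledWinProbs_nonempty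
  have hbound : (2 : ℝ) ^ (-(n : ℝ)) ∈ upperBounds (schurGame n).entangledWinProbs :=
    fun _ hp => le_of_mem_entangledWinProbs_schurGame n hp
  refine ⟨isSchurGameWith_schurGame n, maximalValue_schurGame n, ?_,
    isLUB_csSup hnonempty ⟨_, hbound⟩, csSup_le hnonempty hbound⟩
  rw [← maximalValue_schurGame n]
  exact (schurGame n).isLUB_singleWinProbs
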